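/- Let $p$ be a prime and let $K$ be a field of characteristic $p$ that is complete with respect to a discrete valuation $\nu:K\to\mathbb Z\cup\{\infty\}$, with $\pi\in K$, $\nu(\pi)=1$, and valuation ring $R=\{x\in K:\nu(x)\ge 0\}$. For $x\in K$ put $\wp(x)=x^p-x$. Let $C_p^3=\langle g_1,g_2,g_3\rangle$ be the elementary abelian group of order $p^3$, let $(K[C_p^3])^*$ be the linear dual of the Hopf algebra $K[C_p^3]$, with its convolution product and with the duality pairing $\langle -,-\rangle:(K[C_p^3])^*\times K[C_p^3]\to K$, and let $\xi_{1,0,0},\xi_{0,1,0},\xi_{0,0,1}\in (K[C_p^3])^*$ be the functionals determined by $$\langle \xi_{a,b,c},(g_1-1)^j(g_2-1)^k(g_3-1)^l\rangle=\delta_{a,j}\delta_{b,k}\delta_{c,l},\qquad 0\le j,k,l\le p-1 .$$ For an element $x$ of a $K$-algebra and $y\in K$ let $x^{[y]}=\sum_{m=0}^{p-1}\binom ym (x-1)^m$ be the truncated exponential, where $\binom ym=y(y-1)\cdots(y-m+1)/m!$. Let $i_1,i_2,i_3\ge 0$ be integers and let $\mu,\alpha,\beta\in K$ satisfy $$\nu(\wp(\mu))\ge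 i_2-pi_1,\quad \nu(\wp(\alpha)+\wp(\mu)\beta)\ge i_3-pi_1,\quad \nu(\wp(\beta))\ge i_3-pi_2,\quad \nu(\mu)\ge i_3-i_1,\quad i_2\ge i_3 .$$ Let $$H^*_{i_1,i_2,i_3,\mu,\alpha,\beta}=R\bigl[\pi^{i_1}(\xi_{1,0,0}-\mu\xi_{0,1,0}-\alpha\xi_{0,0,1}),\ \pi^{i_2}(\xi_{0,1,0}-\beta\xi_{0,0,1}),\ \pi^{i_3}\xi_{0,0,1}\bigr]\subseteq (K[C_p^3])^*$$ and $$E(i_1,i_2,i_3,\mu,\alpha,\beta)=R\left[\frac{g_1-1}{\pi^{i_1}},\ \frac{g_2g_1^{[\mu]}-1}{\pi^{i_2}},\ \frac{g_3g_1^{[\alpha]}(g_2g_1^{[\mu]})^{[\beta]}-1}{\pi^{i_3}}\right]\subseteq K[C_p^3].$$ Then $E(i_1,i_2,i_3,\mu,\alpha,\beta)$ is the linear dual of $H^*_{i_1,i_2,i_3,\mu,\alpha,\beta}$: $$\bigl(H^*_{i_1,i_2,i_3,\mu,\alpha,\beta}\bigr)^*=E(i_1,i_2,i_3,\mu,\alpha,\beta).$$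 That is, $E(i_1,i_2,i_3,\mu,\alpha,\beta)=\{x\in K[C_p^3]:\langle f,x\rangle\in R\text{ for all }f\in H^*_{i_1,i_2,i_3,\mu,\alpha,\beta}\}$, and every $R$-linear map $H^*_{i_1,i_2,i_3,\mu,\alpha,\beta}\to R$ is $f\mapsto\langle f,x\rangle$ for exactly one $x\in E(i_1,i_2,i_3,\mu,\alpha,\beta)$. -/

import Mathlib

namespace CpCube

noncomputable section

/-! ### Discretely valued fields -/

section Valuation

variable {K : Type*} [Field K]

/-- The valuation ring `R = {x ∈ K | 0 ≤ ν x}`. -/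
def ring (ν : AddValuation K (WithTop ℤ)) : Subring K where
  carrier := {x | 0 ≤ ν x}
  mul_mem' {a b} ha hb := by
    simp only [Set.mem_ofPred_eq] at *
    rw [ν.map_mul]; exact add_nonneg ha hb
  one_mem' := by simp
  add_mem' {a b} ha hb := by
    simp only [Set.mem_ofPred_eq] at *
    exact ν.map_le_add ha hb
  zero_mem' := by simp
  neg_mem' {a} ha := by
    simp only [Set.mem_ofPred_eq] at *
    rwa [ν.map_neg]

/-- `K` is complete for `ν`: every sequence that is Cauchy with respect to `ν` has a limit in `K`. -/
def IsCompleteFor (ν : AddValuation K (WithTop ℤ)) : Prop :=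
  ∀ s : ℕ → K,
    (∀ n : ℤ, ∃ N : ℕ, ∀ k ≥ N, ∀ l ≥ N, (n : WithTop ℤ) ≤ ν (s k - s l)) →
      ∃ a : K, ∀ n : ℤ, ∃ N : ℕ, ∀ k ≥ N, (n : WithTop ℤ) ≤ ν (s k - a)

/-- `℘(x) = x ^ p - x`. -/
def wp (p : ℕ) (x : K) : K := x ^ p - x

/-- The generalized binomial coefficient `y (y - 1) ⋯ (y - m + 1) / m!`
(used only for `m < p`, where `m!` is invertible in a field of characteristic `p`). -/
def genBinom (y : K) (m : ℕ) : K := (∏ i ∈ Finset.range m, (y - (i : K))) / (m.factorial : K)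

/-- The truncated exponential `x ^ [y] = ∑_{m = 0}^{p - 1} (y choose m) (x - 1) ^ m`,
for a scalar `y` and an element `x` of a `K`-algebra. -/
def truncExp (p : ℕ) {A : Type*} [Ring A] [Algebra K A] (x : A) (y : K) : A :=
  ∑ m ∈ Finset.range p, genBinom y m • (x - 1) ^ m

end Valuation

/-! ### The group `C_p ^ 3`, its group ring and the dual of its group ring -/

/-- The elementary abelian group `C_p ^ 3`, written multiplicatively. -/
abbrev Grp (p : ℕ) : Type := Multiplicative (Fin 3 → ZMod p)

/-- The group ring `K[C_p ^ 3]`. -/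
abbrev GrpRing (K : Type*) [Field K] (p : ℕ) : Type _ := MonoidAlgebra K (Grp p)

/-- The dual `(K[C_p ^ 3])^*`: the `K`-linear functionals on `K[C_p ^ 3]`, with the convolution
product `(f * h)(x) = ∑ f(x₁) h(x₂)` and with the counit of `K[C_p ^ 3]` as its unit. -/
abbrev GrpDual (K : Type*) [Field K] (p : ℕ) : Type _ := WithConv (GrpRing K p →ₗ[K] K)

section Elements

variable (K : Type*) [Field K] (p : ℕ)

/-- The generator `g_{i+1}` of `C_p ^ 3`, as an element of the group ring. -/
def gen (i : Fin 3) : GrpRing K p :=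
  MonoidAlgebra.of K (Grp p) (Multiplicative.ofAdd (Pi.single i 1))

/-- The functional `ξ_{1,0,0}`, `ξ_{0,1,0}` or `ξ_{0,0,1}` for `i = 0, 1, 2`: its value at the group
element `g_1 ^ {a_1} g_2 ^ {a_2} g_3 ^ {a_3}` is `a_{i+1}`. See `xi_apply_monomial` and
`eq_xi_of_apply_monomial` for its description by the values on the basis
`(g_1 - 1) ^ j (g_2 - 1) ^ k (g_3 - 1) ^ l`. -/
def xi [CharP K p] (i : Fin 3) : GrpDual K p :=
  WithConv.toConv ((Finsupp.linearCombination K fun g : Grp p =>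
    ZMod.castHom (dvd_refl p) K (g.toAdd i)) ∘ₗ
      (MonoidAlgebra.coeffLinearEquiv K).toLinearMap)

end Elements

section Facts

variable {K : Type*} [Field K] {p : ℕ}

theorem xi_apply_of [CharP K p] (i : Fin 3) (g : Grp p) :
    xi K p i (MonoidAlgebra.of K (Grp p) g) = ZMod.castHom (dvd_refl p) K (g.toAdd i) := by
  simp [xi]

/-- The augmentation of the group ring. -/
def aug (K : Type*) [Field K] (p : ℕ) : GrpRing K p →ₐ[K] K :=
  MonoidAlgebra.lift K K (Grp p) 1

theorem aug_of (g : Grp p) : aug K p (MonoidAlgebra.of K (Grp p) g) = 1 := by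
  simp [aug]

/-- The functional `ξ_i` is primitive, that is, a derivation at the augmentation. -/
theorem xi_apply_mul [CharP K p] (i : Fin 3) (x y : GrpRing K p) :
    xi K p i (x * y) = aug K p x * xi K p i y + xi K p i x * aug K p y := by
  induction x using MonoidAlgebra.induction_on with
  | of g =>
    induction y using MonoidAlgebra.induction_on with
    | of h =>
      rw [← map_mul, xi_apply_of, xi_apply_of, xi_apply_of, aug_of, aug_of]
      simp [add_comm]
    | add a b ha hb => simp only [mul_add, map_add, ha, hb]; ring
    | smul r a ha => simp only [mul_smul_comm, map_smul, ha, smul_eq_mul]; ring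
  | add a b ha hb => simp only [add_mul, map_add, ha, hb]; ring
  | smul r a ha => simp only [smul_mul_assoc, map_smul, ha, smul_eq_mul]; ring

theorem aug_gen_sub_one (i : Fin 3) : aug K p (gen K p i - 1) = 0 := by
  rw [map_sub, gen, aug_of, map_one, sub_self]

theorem xi_apply_one [CharP K p] (i : Fin 3) : xi K p i 1 = 0 := by
  rw [← map_one (MonoidAlgebra.of K (Grp p)), xi_apply_of]; simp

theorem xi_apply_gen_sub_one [CharP K p] (i j : Fin 3) :
    xi K p i (gen K p j - 1) = if i = j then 1 else 0 := by
  rw [map_sub, gen, xi_apply_of, xi_apply_one, sub_zero, toAdd_ofAdd, Pi.single_apply]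
  split_ifs <;> simp

theorem aug_gen_sub_one_pow (i : Fin 3) (n : ℕ) :
    aug K p ((gen K p i - 1) ^ n) = if n = 0 then 1 else 0 := by
  rw [map_pow, aug_gen_sub_one, zero_pow_eq]

theorem xi_apply_gen_sub_one_pow [CharP K p] (i j : Fin 3) (n : ℕ) :
    xi K p i ((gen K p j - 1) ^ n) = if i = j ∧ n = 1 then 1 else 0 := by
  rcases n with _ | n
  · simp [xi_apply_one]
  · rw [pow_succ, xi_apply_mul, aug_gen_sub_one, aug_gen_sub_one_pow, xi_apply_gen_sub_one]
    by_cases hn : n = 0 <;> by_cases hij : i = j <;> simp [hn, hij]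

/-- The monomial `(g_1 - 1) ^ j (g_2 - 1) ^ k (g_3 - 1) ^ l`. -/
def monomial (K : Type*) [Field K] (p j k l : ℕ) : GrpRing K p :=
  (gen K p 0 - 1) ^ j * (gen K p 1 - 1) ^ k * (gen K p 2 - 1) ^ l

/-- The values of `ξ_{1,0,0}`, `ξ_{0,1,0}`, `ξ_{0,0,1}` on the monomials
`(g_1 - 1) ^ j (g_2 - 1) ^ k (g_3 - 1) ^ l` are the expected Kronecker deltas. -/
theorem xi_apply_monomial [CharP K p] (i : Fin 3) (j k l : ℕ) :
    xi K p i (monomial K p j k l) =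
      if j = (if i = 0 then 1 else 0) ∧ k = (if i = 1 then 1 else 0) ∧
        l = (if i = 2 then 1 else 0) then 1 else 0 := by
  rw [monomial, xi_apply_mul, xi_apply_mul, map_mul]
  simp only [aug_gen_sub_one_pow, xi_apply_gen_sub_one_pow]
  fin_cases i <;> rcases j with _ | _ | j <;> rcases k with _ | _ | k <;>
    rcases l with _ | _ | l <;> simp

/-- The monomials `(g_1 - 1) ^ j (g_2 - 1) ^ k (g_3 - 1) ^ l` with `0 ≤ j, k, l ≤ p - 1` span the
group ring. -/
theorem span_monomial [NeZero p] :
    Submodule.span K {x : GrpRing K p | ∃ j < p, ∃ k < p, ∃ l < p, x = monomial K p j k l} = ⊤ := by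
  have hpow : ∀ (i : Fin 3) (n : ℕ), gen K p i ^ n =
      ∑ m ∈ Finset.range (n + 1), (n.choose m : K) • (gen K p i - 1) ^ m := by
    intro i n
    conv_lhs => rw [← sub_add_cancel (gen K p i) 1, add_pow]
    refine Finset.sum_congr rfl fun m _ => ?_
    rw [one_pow, mul_one, Algebra.smul_def, map_natCast, mul_comm]
  rw [eq_top_iff]
  rintro x -
  induction x using MonoidAlgebra.induction_on with
  | of g =>
    have hg : MonoidAlgebra.of K (Grp p) g = gen K p 0 ^ (g.toAdd 0).val *
        gen K p 1 ^ (g.toAdd 1).val * gen K p 2 ^ (g.toAdd 2).val := by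
      simp only [gen, ← map_pow, ← map_mul]
      congr 1
      apply Multiplicative.toAdd.injective
      ext i
      fin_cases i <;> simp [-ZMod.natCast_val, ZMod.natCast_zmod_val]
    rw [hg, hpow, hpow, hpow, Finset.sum_mul_sum, Finset.sum_mul]
    refine Submodule.sum_mem _ fun j hj => ?_
    rw [Finset.sum_mul_sum]
    refine Submodule.sum_mem _ fun k hk => Submodule.sum_mem _ fun l hl => ?_
    rw [smul_mul_smul_comm, smul_mul_smul_comm]
    refine Submodule.smul_mem _ _ (Submodule.subset_span ⟨j, ?_, k, ?_, l, ?_, rfl⟩)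
    · have := ZMod.val_lt (g.toAdd 0); have := Finset.mem_range.1 hj; omega
    · have := ZMod.val_lt (g.toAdd 1); have := Finset.mem_range.1 hk; omega
    · have := ZMod.val_lt (g.toAdd 2); have := Finset.mem_range.1 hl; omega
  | add a b ha hb => exact Submodule.add_mem _ ha hb
  | smul r a ha => exact Submodule.smul_mem _ _ ha

/-- The functional `ξ_i` is the only one with those values on the monomials with
`0 ≤ j, k, l ≤ p - 1`. -/
theorem eq_xi_of_apply_monomial [CharP K p] [NeZero p] (i : Fin 3) (f : GrpDual K p)
    (hf : ∀ j < p, ∀ k < p, ∀ l < p, f (monomial K p j k l) =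
      if j = (if i = 0 then 1 else 0) ∧ k = (if i = 1 then 1 else 0) ∧
        l = (if i = 2 then 1 else 0) then 1 else 0) :
    f = xi K p i := by
  apply WithConv.ofConv_injective
  refine LinearMap.ext_on span_monomial ?_
  rintro _ ⟨j, hj, k, hk, l, hl, rfl⟩
  exact (hf j hj k hk l hl).trans (xi_apply_monomial i j k l).symm

end Facts

/-! ### The two families of orders and the linear dual -/

section Orders

variable {K : Type*} [Field K] (ν : AddValuation K (WithTop ℤ)) (p : ℕ)

/-- The `R`-subalgebra `H^*_{i_1,i_2,i_3,μ,α,β}` of `(K[C_p ^ 3])^*`, namely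
`R[π^{i_1}(ξ_{1,0,0} - μ ξ_{0,1,0} - α ξ_{0,0,1}), π^{i_2}(ξ_{0,1,0} - β ξ_{0,0,1}),
π^{i_3} ξ_{0,0,1}]`. -/
def Hstar [CharP K p] (π : K) (i₁ i₂ i₃ : ℕ) (μ α β : K) :
    Subalgebra (ring ν) (GrpDual K p) :=
  Algebra.adjoin (ring ν)
    {π ^ i₁ • (xi K p 0 - μ • xi K p 1 - α • xi K p 2),
      π ^ i₂ • (xi K p 1 - β • xi K p 2),
      π ^ i₃ • xi K p 2}

/-- The `R`-subalgebra `E(i_1,i_2,i_3,μ,α,β)` of `K[C_p ^ 3]`, namely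
`R[(g_1 - 1)/π^{i_1}, (g_2 g_1^{[μ]} - 1)/π^{i_2},
(g_3 g_1^{[α]} (g_2 g_1^{[μ]})^{[β]} - 1)/π^{i_3}]`. -/
def E (π : K) (i₁ i₂ i₃ : ℕ) (μ α β : K) : Subalgebra (ring ν) (GrpRing K p) :=
  Algebra.adjoin (ring ν)
    {(π ^ i₁)⁻¹ • (gen K p 0 - 1),
      (π ^ i₂)⁻¹ • (gen K p 1 * truncExp p (gen K p 0) μ - 1),
      (π ^ i₃)⁻¹ • (gen K p 2 * truncExp p (gen K p 0) α *
        truncExp p (gen K p 1 * truncExp p (gen K p 0) μ) β - 1)}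

/-- The linear dual `J^*` of an `R`-submodule `J` of `(K[C_p ^ 3])^*`, as an `R`-submodule of
`K[C_p ^ 3]`: all `x` with `⟨f, x⟩ ∈ R` for every `f ∈ J`. -/
def linearDual (J : Submodule (ring ν) (GrpDual K p)) : Submodule (ring ν) (GrpRing K p) where
  carrier := {x | ∀ f ∈ J, f x ∈ ring ν}
  add_mem' {a b} ha hb f hf := by
    rw [map_add]; exact add_mem (ha f hf) (hb f hf)
  zero_mem' f _ := by rw [map_zero]; exact zero_mem _
  smul_mem' c x hx f hf := by
    have h : f (c • x) = (c : K) * f x := map_smul f.ofConv (c : K) x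
    rw [h]; exact mul_mem c.2 (hx f hf)

end Orders

end

end CpCube

namespace CpCube

/-! ### Finite differences and separation of variables. -/

noncomputable section

/-! Group elements are grouplike, so `GrpDual` is the algebra of functions on the group, with the
ξ's as coordinate functions. If n ↦ φ(z g^n) is a polynomial P of degree below p, Newton
interpolation gives φ(z g^{[y]}) = P(y): the truncated exponential acts as a y-th power
(`apply_mul_newtonSeries`). Hence the twists by g₁^{[μ]}, g₁^{[α]} and (g₂ g₁^{[μ]})^{[β]} undo the
linear change of coordinates on the dual side, and each monomial in the new coordinates takes the
value n^a m^b k^c on powers of the twisted generators (`dualMonomial_apply_twist`).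

This separates the variables. Newton series of coefficient functionals give a dual basis, whose
rescaling lies in `E` (`scaledElement_mem_E`). Conversely, elements of `E` pair integrally with the
scaled monomials, since the i-th difference of n^a is an integer and vanishes for i > a
(`scaledMonomial_apply_mem_ring`).

The valuation bounds make the p-th power of each generator of `Hstar` an R-combination of the
generators, so monomials with exponents below p span `Hstar` (`Hstar_le_of_scaledMonomial_mem`).
These monomials and the dual elements in `E` are therefore dual R-bases. -/

theorem apply_mul_sub_one_pow {K A : Type*} [Field K] [CommRing A] [Algebra K A]
    (φ : A →ₗ[K] K) (z g : A) (c : K) {a : ℕ}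
    (h : ∀ n : ℕ, φ (z * g ^ n) = c * n ^ a) (i : ℕ) :
    φ (z * (g - 1) ^ i) = c * ((fwdDiff 1)^[i] (fun n : ℤ => n ^ a) 0 : ℤ) := by
  rw [fwdDiff_iter_eq_sum_shift, sub_eq_add_neg, add_pow, Finset.mul_sum, map_sum]
  push_cast
  rw [Finset.mul_sum]
  refine Finset.sum_congr rfl fun m _ => ?_
  have : z * (g ^ m * (-1) ^ (i - m) * (i.choose m : A)) =
      ((-1) ^ (i - m) * (i.choose m : K)) • (z * g ^ m) := by
    rw [Algebra.smul_def]
    simp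
    ring
  rw [this, map_smul, h]
  simp
  ring

/-- The variables are replaced one at a time; the other two factors are absorbed into `w` and
contribute only the scalar `q`. -/
theorem apply_mul_mul_of_apply_pow_mul_pow_mul_pow {K A : Type*} [Field K] [CommRing A]
    [Algebra K A] (φ : A →ₗ[K] K) {x y z x' y' z' : A} {a b c : ℕ} {r s t : K}
    (h : ∀ n m k : ℕ, φ (x ^ n * y ^ m * z ^ k) = n ^ a * m ^ b * k ^ c)
    (hx : ∀ w q, (∀ n : ℕ, φ (w * x ^ n) = q * n ^ a) → φ (w * x') = q * r)
    (hy : ∀ w q, (∀ n : ℕ, φ (w * y ^ n) = q * n ^ b) → φ (w * y') = q * s)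
    (hz : ∀ w q, (∀ n : ℕ, φ (w * z ^ n) = q * n ^ c) → φ (w * z') = q * t) :
    φ (x' * y' * z') = r * s * t := by
  have h₁ (m k : ℕ) : φ (y ^ m * z ^ k * x') = m ^ b * k ^ c * r := by
    refine hx _ _ fun n => ?_
    rw [mul_comm, ← mul_assoc, h]
    ring
  have h₂ (k : ℕ) : φ (x' * z ^ k * y') = r * k ^ c * s := by
    refine hy _ _ fun m => ?_
    rw [show x' * z ^ k * y ^ m = y ^ m * z ^ k * x' by ring, h₁]
    ring
  refine hz _ _ fun k => ?_
  rw [mul_right_comm, h₂]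
  ring

/-! ### Newton interpolation and truncated exponentials. -/

section Newton

open Polynomial

variable {K : Type*} [Field K] {p : ℕ} [Fact p.Prime] [CharP K p]

theorem factorial_cast_ne_zero {m : ℕ} (hm : m < p) : (m.factorial : K) ≠ 0 := by
  rw [Ne, CharP.cast_eq_zero_iff K p, (Fact.out : p.Prime).dvd_factorial]
  exact not_le.2 hm

variable (K p) in
/-- The polynomial `X (X - 1) ⋯ (X - m + 1) / m!`, which has coefficients in the prime field. -/
def binomPoly (m : ℕ) : K[X] :=
  (C (m.factorial : ZMod p)⁻¹ * ∏ i ∈ Finset.range m, (X - C (i : ZMod p))).map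
    (ZMod.castHom (dvd_refl p) K)

theorem eval_binomPoly (m : ℕ) (y : K) : (binomPoly K p m).eval y = genBinom y m := by
  simp [binomPoly, genBinom, Polynomial.map_prod, eval_prod, div_eq_inv_mul]

theorem degree_binomPoly_le (m : ℕ) : (binomPoly K p m).degree ≤ m := by
  rw [binomPoly, ← smul_eq_C_mul]
  refine degree_map_le.trans ((degree_smul_le _ _).trans ?_)
  rw [degree_prod]
  simp only [degree_X_sub_C, Finset.sum_const, Finset.card_range, nsmul_one]
  exact le_rfl

theorem coeff_binomPoly_of_lt {m a : ℕ} (h : m < a) : (binomPoly K p m).coeff a = 0 :=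
  coeff_eq_zero_of_degree_lt ((degree_binomPoly_le m).trans_lt (by exact_mod_cast h))

theorem genBinom_natCast {m : ℕ} (hm : m < p) (n : ℕ) : genBinom (n : K) m = (n.choose m : K) := by
  rw [genBinom, div_eq_iff (factorial_cast_ne_zero hm), mul_comm, ← Nat.cast_mul,
    ← Nat.descFactorial_eq_factorial_mul_choose, ← descPochhammer_eval_eq_descFactorial K,
    descPochhammer_eval_eq_prod_range]

/-- The coefficients lie in the prime field, hence in every subring of K; this gives integrality of
the Newton series. -/
theorem coeff_binomPoly_eq_natCast (m a : ℕ) : ∃ n : ℕ, (binomPoly K p m).coeff a = n := by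
  rw [binomPoly, coeff_map]
  exact ⟨_, by rw [← ZMod.natCast_zmod_val (coeff _ a), map_natCast]⟩

variable (p) in
/-- The Newton series `∑_{m < p} Λ (X choose m) (g - 1) ^ m` of a functional `Λ` on polynomials. -/
def newtonSeries {A : Type*} [Ring A] [Algebra K A] (Λ : K[X] →ₗ[K] K) (g : A) : A :=
  ∑ m ∈ Finset.range p, Λ (binomPoly K p m) • (g - 1) ^ m

theorem truncExp_eq_newtonSeries {A : Type*} [Ring A] [Algebra K A] (g : A) (y : K) :
    truncExp p g y = newtonSeries p (leval y) g := by
  simp [truncExp, newtonSeries, eval_binomPoly]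

variable {A : Type*} [CommRing A] [Algebra K A]

/-- Newton interpolation: if `n ↦ φ (z g ^ n)` is a polynomial function of degree less than `p`,
then the Newton series of `Λ` at `g` evaluates this polynomial at `Λ`. -/
theorem apply_mul_newtonSeries (φ : A →ₗ[K] K) (z g : A) (P : K[X]) (hP : P.degree < p)
    (h : ∀ n : ℕ, φ (z * g ^ n) = P.eval (n : K)) (Λ : K[X] →ₗ[K] K) :
    φ (z * newtonSeries p Λ g) = Λ P := by
  -- Both sides have degree below p and agree at 0, …, p - 1, which are distinct in characteristic
  -- p.
  have hPeq : P = ∑ m ∈ Finset.range p, φ (z * (g - 1) ^ m) • binomPoly K p m := by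
    have hinj : Set.InjOn (fun n : ℕ => (n : K)) (Finset.range p : Set ℕ) := by
      intro a ha b hb hab
      have := (CharP.natCast_eq_natCast K p).1 hab
      rwa [Nat.ModEq, Nat.mod_eq_of_lt (by simpa using ha),
        Nat.mod_eq_of_lt (by simpa using hb)] at this
    refine eq_of_degrees_lt_of_eval_index_eq (Finset.range p) hinj (by simpa using hP) ?_ ?_
    · rw [Finset.card_range]
      refine (degree_sum_le _ _).trans_lt ((Finset.sup_lt_iff (WithBot.bot_lt_coe p)).2 ?_)
      intro m hm
      exact ((degree_smul_le _ _).trans (degree_binomPoly_le m)).trans_lt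
        (Nat.cast_lt.2 (Finset.mem_range.1 hm))
    · intro n hn
      have hpow : g ^ n = ∑ m ∈ Finset.range p, (n.choose m : K) • (g - 1) ^ m := by
        conv_lhs => rw [← sub_add_cancel g 1, add_pow]
        rw [Finset.sum_subset (Finset.range_subset_range.2 (Finset.mem_range.1 hn))]
        · refine Finset.sum_congr rfl fun m _ => ?_
          rw [one_pow, mul_one, Algebra.smul_def, map_natCast, mul_comm]
        · intro m _ hm
          rw [Nat.choose_eq_zero_of_lt (by rw [Finset.mem_range] at hm; omega)]
          simp
      rw [← h, hpow, Finset.mul_sum, map_sum, eval_finsetSum]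
      refine Finset.sum_congr rfl fun m hm => ?_
      rw [eval_smul, eval_binomPoly, genBinom_natCast (Finset.mem_range.1 hm), mul_smul_comm,
        map_smul, smul_eq_mul, smul_eq_mul, mul_comm]
  conv_rhs => rw [hPeq]
  rw [newtonSeries, Finset.mul_sum, map_sum, map_sum]
  refine Finset.sum_congr rfl fun m _ => ?_
  rw [mul_smul_comm, map_smul, map_smul, smul_eq_mul, smul_eq_mul, mul_comm]

/-- As a < p, interpolation is exact: multiplying by g^{[y]} translates the variable n by y. -/
theorem apply_mul_truncExp_mul_pow (φ : A →ₗ[K] K) (z g : A) (c s y : K) {a : ℕ} (ha : a < p)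
    (h : ∀ n : ℕ, φ (z * g ^ n) = c * (n - s) ^ a) (n : ℕ) :
    φ (z * truncExp p g y * g ^ n) = c * (n + y - s) ^ a := by
  rw [truncExp_eq_newtonSeries, mul_right_comm,
    apply_mul_newtonSeries φ (z * g ^ n) g (C c * (X + C (n - s)) ^ a)]
  · simp only [leval_apply, eval_mul, eval_C, eval_pow, eval_add, eval_X]
    ring
  · rw [← smul_eq_C_mul]
    refine (degree_smul_le _ _).trans_lt ?_
    rw [degree_pow, degree_X_add_C]
    simpa using ha
  · intro k
    rw [mul_assoc, ← pow_add, h]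
    simp only [eval_mul, eval_C, eval_pow, eval_add, eval_X]
    push_cast
    ring

theorem apply_mul_truncExp_pow_mul_pow (φ : A →ₗ[K] K) (z g : A) (c s y : K) {a : ℕ} (ha : a < p)
    (h : ∀ n : ℕ, φ (z * g ^ n) = c * (n - s) ^ a) (k n : ℕ) :
    φ (z * truncExp p g y ^ k * g ^ n) = c * (n - (s - k * y)) ^ a := by
  induction k generalizing n with
  | zero => simp [h]
  | succ k ih =>
    rw [pow_succ, ← mul_assoc, apply_mul_truncExp_mul_pow φ _ g c _ y ha ih]
    push_cast
    ring

/-- If `φ` is a product of powers of the linear forms `n - μ m - α k`, `m - β k` and `k` on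
`x ^ n y ^ m z ^ k`, then passing to truncated exponentials diagonalizes these forms. -/
theorem apply_pow_mul_pow_mul_pow_of_truncExp (φ : A →ₗ[K] K) {x y z h t : A} {μ α β : K}
    {a b c : ℕ} (ha : a < p) (hb : b < p)
    (hφ : ∀ n m k : ℕ, φ (x ^ n * y ^ m * z ^ k) =
      (n - μ * m - α * k) ^ a * (m - β * k) ^ b * k ^ c)
    (hh : h = y * truncExp p x μ) (ht : t = z * truncExp p x α * truncExp p h β) (n m k : ℕ) :
    φ (x ^ n * h ^ m * t ^ k) = n ^ a * m ^ b * k ^ c := by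
  -- In the variable n the zero sits at mμ + kα; m factors x^{[μ]} and k factors x^{[α]} move it to
  -- 0. Then k factors h^{[β]} do the same for kβ in the variable m.
  have h₁ (m n : ℕ) : φ (y ^ m * z ^ k * x ^ n) =
      ((m - β * k) ^ b * k ^ c) * (n - (m * μ + k * α)) ^ a := by
    rw [show y ^ m * z ^ k * x ^ n = x ^ n * y ^ m * z ^ k by ring, hφ]
    ring
  have h₂ (m : ℕ) : φ (x ^ n * z ^ k * truncExp p x α ^ k * h ^ m) =
      (n ^ a * k ^ c) * (m - k * β) ^ b := by
    have := apply_mul_truncExp_pow_mul_pow φ _ x _ _ α ha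
      (apply_mul_truncExp_pow_mul_pow φ _ x _ _ μ ha (h₁ m) m) k n
    rw [hh, mul_pow, show x ^ n * z ^ k * truncExp p x α ^ k * (y ^ m * truncExp p x μ ^ m) =
      y ^ m * z ^ k * truncExp p x μ ^ m * truncExp p x α ^ k * x ^ n by ring, this]
    ring
  rw [ht, mul_pow, mul_pow, show x ^ n * h ^ m *
    (z ^ k * truncExp p x α ^ k * truncExp p h β ^ k) =
      x ^ n * z ^ k * truncExp p x α ^ k * truncExp p h β ^ k * h ^ m by ring,
    apply_mul_truncExp_pow_mul_pow φ _ h _ _ β hb h₂]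
  ring

/-- The Newton series of the `a`-th coefficient. -/
theorem apply_mul_newtonSeries_lcoeff (φ : A →ₗ[K] K) (z g : A) (c : K) {a : ℕ} (ha : a < p)
    (h : ∀ n : ℕ, φ (z * g ^ n) = c * n ^ a) (b : ℕ) :
    φ (z * newtonSeries p (lcoeff K b) g) = c * if b = a then 1 else 0 := by
  rw [apply_mul_newtonSeries φ z g (C c * X ^ a)]
  · simp [coeff_X_pow]
  · exact (degree_C_mul_X_pow_le _ _).trans_lt (by exact_mod_cast ha)
  · simp [h]

end Newton

/-! ### Pairing of monomials with the twisted generators. -/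

section Pairing

open Polynomial

variable {K : Type*} [Field K] {p : ℕ}

/-- Group elements are grouplike, so convolution is pointwise multiplication there. -/
theorem conv_mul_apply_of (f h : GrpDual K p) (g : Grp p) :
    (f * h) (MonoidAlgebra.of K (Grp p) g) =
      f (MonoidAlgebra.of K (Grp p) g) * h (MonoidAlgebra.of K (Grp p) g) := by
  simp

theorem conv_one_apply_of (g : Grp p) : (1 : GrpDual K p) (MonoidAlgebra.of K (Grp p) g) = 1 := by
  simp

theorem conv_pow_apply_of (f : GrpDual K p) (n : ℕ) (g : Grp p) :
    (f ^ n) (MonoidAlgebra.of K (Grp p) g) = f (MonoidAlgebra.of K (Grp p) g) ^ n := by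
  induction n with
  | zero => rw [pow_zero, pow_zero, conv_one_apply_of]
  | succ n ih => rw [pow_succ, conv_mul_apply_of, ih, pow_succ]

theorem dual_ext_of {f h : GrpDual K p}
    (hfh : ∀ g, f (MonoidAlgebra.of K (Grp p) g) = h (MonoidAlgebra.of K (Grp p) g)) : f = h := by
  apply WithConv.ofConv_injective
  ext g
  simpa using hfh g

theorem gen_pow_mul_eq_of (n m k : ℕ) :
    gen K p 0 ^ n * gen K p 1 ^ m * gen K p 2 ^ k =
      MonoidAlgebra.of K (Grp p) (Multiplicative.ofAdd ![(n : ZMod p), m, k]) := by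
  simp only [gen, ← map_pow, ← map_mul]
  congr 1
  apply Multiplicative.toAdd.injective
  ext i
  fin_cases i <;> simp

variable [CharP K p]

variable (p) in
/-- The monomial `(ξ₁ - μ ξ₂ - α ξ₃) ^ a (ξ₂ - β ξ₃) ^ b ξ₃ ^ c` in the dual of the group ring. -/
def dualMonomial (μ α β : K) (a b c : ℕ) : GrpDual K p :=
  (xi K p 0 - μ • xi K p 1 - α • xi K p 2) ^ a * (xi K p 1 - β • xi K p 2) ^ b * xi K p 2 ^ c

theorem dualMonomial_apply_gen (μ α β : K) (a b c n m k : ℕ) :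
    dualMonomial p μ α β a b c (gen K p 0 ^ n * gen K p 1 ^ m * gen K p 2 ^ k) =
      (n - μ * m - α * k) ^ a * (m - β * k) ^ b * k ^ c := by
  rw [gen_pow_mul_eq_of, dualMonomial, conv_mul_apply_of, conv_mul_apply_of, conv_pow_apply_of,
    conv_pow_apply_of, conv_pow_apply_of]
  simp only [WithConv.ofConv_sub, WithConv.ofConv_smul, LinearMap.sub_apply, LinearMap.smul_apply,
    xi_apply_of]
  simp

/-- `g₂ g₁^{[μ]}` -/
def twistTwo (p : ℕ) (μ : K) : GrpRing K p := gen K p 1 * truncExp p (gen K p 0) μ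

/-- `g₃ g₁^{[α]} (g₂ g₁^{[μ]})^{[β]}` -/
def twistThree (p : ℕ) (μ α β : K) : GrpRing K p :=
  gen K p 2 * truncExp p (gen K p 0) α * truncExp p (twistTwo p μ) β

variable [Fact p.Prime] (μ α β : K) {a b c : ℕ}

/-- In the coordinates `ξ₁ - μ ξ₂ - α ξ₃`, `ξ₂ - β ξ₃`, `ξ₃`, the elements `g₁`, `g₂ g₁^{[μ]}` and
`g₃ g₁^{[α]} (g₂ g₁^{[μ]})^{[β]}` behave like the standard basis vectors. -/
theorem dualMonomial_apply_twist (ha : a < p) (hb : b < p) (n m k : ℕ) :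
    dualMonomial p μ α β a b c (gen K p 0 ^ n * twistTwo p μ ^ m * twistThree p μ α β ^ k) =
      n ^ a * m ^ b * k ^ c :=
  apply_pow_mul_pow_mul_pow_of_truncExp _ ha hb (dualMonomial_apply_gen μ α β a b c) rfl rfl n m k

/-- The element of the group ring dual to `dualMonomial p μ α β a b c`. -/
def dualElement (p : ℕ) [Fact p.Prime] [CharP K p] (μ α β : K) (a b c : ℕ) : GrpRing K p :=
  newtonSeries p (lcoeff K a) (gen K p 0) * newtonSeries p (lcoeff K b) (twistTwo p μ) *
    newtonSeries p (lcoeff K c) (twistThree p μ α β)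

theorem dualMonomial_apply_dualElement (ha : a < p) (hb : b < p) (hc : c < p) (a' b' c' : ℕ) :
    dualMonomial p μ α β a b c (dualElement p μ α β a' b' c') =
      if a' = a ∧ b' = b ∧ c' = c then 1 else 0 := by
  rw [dualElement, apply_mul_mul_of_apply_pow_mul_pow_mul_pow _
    (dualMonomial_apply_twist (c := c) μ α β ha hb)
    (fun w q h => apply_mul_newtonSeries_lcoeff _ w _ q ha h a')
    (fun w q h => apply_mul_newtonSeries_lcoeff _ w _ q hb h b')
    (fun w q h => apply_mul_newtonSeries_lcoeff _ w _ q hc h c')]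
  split_ifs <;> simp_all

theorem dualMonomial_apply_sub_one_pow (ha : a < p) (hb : b < p) (i j k : ℕ) :
    dualMonomial p μ α β a b c ((gen K p 0 - 1) ^ i * (twistTwo p μ - 1) ^ j *
      (twistThree p μ α β - 1) ^ k) =
      ((fwdDiff 1)^[i] (fun n : ℤ => n ^ a) 0 : ℤ) * ((fwdDiff 1)^[j] (fun n : ℤ => n ^ b) 0 : ℤ) *
        ((fwdDiff 1)^[k] (fun n : ℤ => n ^ c) 0 : ℤ) :=
  apply_mul_mul_of_apply_pow_mul_pow_mul_pow _
    (dualMonomial_apply_twist (c := c) μ α β ha hb)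
    (fun w q h => apply_mul_sub_one_pow _ w _ q h i)
    (fun w q h => apply_mul_sub_one_pow _ w _ q h j)
    (fun w q h => apply_mul_sub_one_pow _ w _ q h k)

end Pairing

/-! ### Dual bases and spanning sets of monomials. -/

section Lattices

open Polynomial

/-- Biorthogonality forces linear independence of `v`, and the cardinality makes it a basis. -/
theorem eq_sum_apply_smul_of_dual {ι K V : Type*} [Fintype ι] [DecidableEq ι] [Field K]
    [AddCommGroup V] [Module K V] [FiniteDimensional K V] (f : ι → V →ₗ[K] K) (v : ι → V)
    (hfv : ∀ i j, f i (v j) = if j = i then 1 else 0)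
    (hcard : Fintype.card ι = Module.finrank K V) (x : V) : x = ∑ i, f i x • v i := by
  have hsum (r : ι → K) (i : ι) : f i (∑ j, r j • v j) = r i := by
    simp [hfv]
  have hli : LinearIndependent K v := Fintype.linearIndependent_iff.2 fun r hr i => by
    rw [← hsum r i, hr, map_zero]
  have hx : x ∈ Submodule.span K (Set.range v) := by
    rw [hli.span_eq_top_of_card_eq_finrank' hcard]
    trivial
  obtain ⟨r, rfl⟩ := (Submodule.mem_span_range_iff_exists_fun K).1 hx
  simp_rw [hsum]

theorem eq_sum_dualMonomial_smul_dualElement {K : Type*} [Field K] {p : ℕ} [Fact p.Prime]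
    [CharP K p] (μ α β : K) (x : GrpRing K p) :
    x = ∑ q : Fin p × Fin p × Fin p, dualMonomial p μ α β q.1 q.2.1 q.2.2 x •
      dualElement p μ α β q.1 q.2.1 q.2.2 := by
  have : FiniteDimensional K (GrpRing K p) :=
    Module.Finite.equiv (MonoidAlgebra.coeffLinearEquiv K).symm
  refine eq_sum_apply_smul_of_dual
    (fun q : Fin p × Fin p × Fin p => (dualMonomial p μ α β q.1 q.2.1 q.2.2).ofConv) _ ?_ ?_ x
  · intro q q'
    rw [dualMonomial_apply_dualElement μ α β q.1.2 q.2.1.2 q.2.2.2]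
    simp [Prod.ext_iff, Fin.ext_iff]
  · rw [(MonoidAlgebra.coeffLinearEquiv K).finrank_eq, Module.finrank_finsupp_self]
    simp
    ring

theorem closure_triple_subset {M : Type*} [CommMonoid M] {x y z w : M}
    (hw : w ∈ Submonoid.closure {x, y, z}) : ∃ i j k : ℕ, w = x ^ i * y ^ j * z ^ k := by
  induction hw using Submonoid.closure_induction with
  | mem w hw =>
    rcases hw with rfl | rfl | rfl
    · exact ⟨1, 0, 0, by simp⟩
    · exact ⟨0, 1, 0, by simp⟩
    · exact ⟨0, 0, 1, by simp⟩
  | one => exact ⟨0, 0, 0, by simp⟩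
  | mul w w' _ _ h h' =>
    obtain ⟨i, j, k, rfl⟩ := h
    obtain ⟨i', j', k', rfl⟩ := h'
    refine ⟨i + i', j + j', k + k', ?_⟩
    simp only [pow_add]
    simp only [mul_assoc, mul_left_comm]

theorem pow_mul_pow_mul_pow_mem_adjoin {R B : Type*} [CommRing R] [CommRing B] [Algebra R B]
    (x y z : B) (a b c : ℕ) : x ^ a * y ^ b * z ^ c ∈ Algebra.adjoin R {x, y, z} :=
  mul_mem (mul_mem (pow_mem (Algebra.subset_adjoin (by simp)) _)
    (pow_mem (Algebra.subset_adjoin (by simp)) _)) (pow_mem (Algebra.subset_adjoin (by simp)) _)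

/-- If the `p`-th powers of `x`, `y`, `z` are linear combinations of `x`, `y`, `z`, then `R[x, y, z]`
is spanned by the monomials of degree less than `p` in each variable. -/
theorem adjoin_triple_le_span {R B : Type*} [CommRing R] [CommRing B] [Algebra R B]
    {x y z : B} {p : ℕ} (hp : 2 ≤ p) {M : Submodule R B}
    (hM : ∀ a < p, ∀ b < p, ∀ c < p, x ^ a * y ^ b * z ^ c ∈ M)
    (hx : ∃ r s t : R, x ^ p = r • x + s • y + t • z)
    (hy : ∃ r s t : R, y ^ p = r • x + s • y + t • z)
    (hz : ∃ r s t : R, z ^ p = r • x + s • y + t • z) :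
    Subalgebra.toSubmodule (Algebra.adjoin R {x, y, z}) ≤ M := by
  have key (n a b c : ℕ) (hn : a + b + c = n) : x ^ a * y ^ b * z ^ c ∈ M := by
    induction n using Nat.strong_induction_on generalizing a b c with
    | _ n ih =>
      -- Trading a p-th power for a linear form lowers the total degree by p - 1 ≥ 1, so the
      -- induction applies.
      have step (w : B) (hw : ∃ r s t : R, w = r • x + s • y + t • z) (i j k : ℕ)
          (hijk : i + j + k + 1 < n) : w * (x ^ i * y ^ j * z ^ k) ∈ M := by
        obtain ⟨r, s, t, rfl⟩ := hw
        have : (r • x + s • y + t • z) * (x ^ i * y ^ j * z ^ k) =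
            r • (x ^ (i + 1) * y ^ j * z ^ k) + s • (x ^ i * y ^ (j + 1) * z ^ k) +
              t • (x ^ i * y ^ j * z ^ (k + 1)) := by
          simp only [Algebra.smul_def]
          ring
        rw [this]
        exact add_mem (add_mem (M.smul_mem _ (ih _ (by omega) _ _ _ rfl))
          (M.smul_mem _ (ih _ (by omega) _ _ _ rfl))) (M.smul_mem _ (ih _ (by omega) _ _ _ rfl))
      by_cases ha : p ≤ a
      · obtain ⟨a, rfl⟩ := Nat.exists_eq_add_of_le ha
        rw [show x ^ (p + a) * y ^ b * z ^ c = x ^ p * (x ^ a * y ^ b * z ^ c) by ring]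
        exact step _ hx _ _ _ (by omega)
      by_cases hb : p ≤ b
      · obtain ⟨b, rfl⟩ := Nat.exists_eq_add_of_le hb
        rw [show x ^ a * y ^ (p + b) * z ^ c = y ^ p * (x ^ a * y ^ b * z ^ c) by ring]
        exact step _ hy _ _ _ (by omega)
      by_cases hc : p ≤ c
      · obtain ⟨c, rfl⟩ := Nat.exists_eq_add_of_le hc
        rw [show x ^ a * y ^ b * z ^ (p + c) = z ^ p * (x ^ a * y ^ b * z ^ c) by ring]
        exact step _ hz _ _ _ (by omega)
      exact hM a (by omega) b (by omega) c (by omega)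
  rw [Algebra.adjoin_eq_span, Submodule.span_le]
  intro w hw
  obtain ⟨i, j, k, rfl⟩ := closure_triple_subset hw
  exact key _ i j k rfl

end Lattices

/-! ### Integrality over the valuation ring. -/

section Integrality

open Polynomial

variable {K : Type*} [Field K] (ν : AddValuation K (WithTop ℤ))

theorem mem_ring_iff {x : K} : x ∈ ring ν ↔ 0 ≤ ν x := Iff.rfl

variable {ν}

theorem mem_ring_of_valuation_eq_one {π : K} (hπ : ν π = 1) : π ∈ ring ν := by
  rw [mem_ring_iff, hπ]
  exact zero_le_one

theorem ne_zero_of_valuation_eq_one {π : K} (hπ : ν π = 1) : π ≠ 0 := by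
  rintro rfl
  rw [ν.map_zero] at hπ
  exact absurd hπ (WithTop.coe_ne_top (a := (1 : ℤ))).symm

theorem pow_mul_div_pow_mem_ring {π x : K} (hπ : ν π = 1) {i j : ℕ}
    (h : (((j : ℤ) - i : ℤ) : WithTop ℤ) ≤ ν x) : π ^ i * x / π ^ j ∈ ring ν := by
  have hπ0 := ne_zero_of_valuation_eq_one hπ
  have hpow (n : ℕ) : ν (π ^ n) = ((n : ℤ) : WithTop ℤ) := by
    rw [ν.map_pow, hπ]
    simp
  have hν : ν (π ^ i * x / π ^ j) + ν (π ^ j) = ν (π ^ i) + ν x := by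
    rw [← ν.map_mul, ← ν.map_mul, div_mul_cancel₀ _ (pow_ne_zero _ hπ0)]
  rw [mem_ring_iff]
  rw [hpow, hpow] at hν
  generalize ν (π ^ i * x / π ^ j) = s at *
  generalize ν x = t at *
  induction s using WithTop.recTopCoe with
  | top => exact le_top
  | coe s =>
    induction t using WithTop.recTopCoe with
    | top => exact absurd hν (by rw [add_top, ← WithTop.coe_add]; exact WithTop.coe_ne_top)
    | coe t =>
      rw [← WithTop.coe_add, ← WithTop.coe_add, WithTop.coe_inj] at hν
      rw [WithTop.coe_le_coe] at h
      rw [← WithTop.coe_zero, WithTop.coe_le_coe]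
      omega

/-- Only terms with m ≥ a survive, because `binomPoly` has degree at most m; for them s^{-a}(g -
1)^m = s^{m-a}(s^{-1}(g - 1))^m. -/
theorem smul_newtonSeries_lcoeff_mem {p : ℕ} [Fact p.Prime] [CharP K p] {A : Type*} [Ring A]
    [Algebra K A] [Algebra (ring ν) A] [IsScalarTower (ring ν) K A] (S : Subalgebra (ring ν) A)
    {s : K} (hs : s ∈ ring ν) (hs0 : s ≠ 0) {g : A} (hg : s⁻¹ • (g - 1) ∈ S) (a : ℕ) :
    (s ^ a)⁻¹ • newtonSeries p (lcoeff K a) g ∈ S := by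
  rw [newtonSeries, Finset.smul_sum]
  refine sum_mem fun m _ => ?_
  rw [lcoeff_apply]
  rcases lt_or_ge m a with hma | hma
  · rw [coeff_binomPoly_of_lt hma, zero_smul, smul_zero]
    exact zero_mem _
  · obtain ⟨n, hn⟩ := coeff_binomPoly_eq_natCast (K := K) (p := p) m a
    obtain ⟨d, rfl⟩ := Nat.exists_eq_add_of_le hma
    have : (s ^ a)⁻¹ • (binomPoly K p (a + d)).coeff a • (g - 1) ^ (a + d) =
        (n * ⟨s, hs⟩ ^ d : ring ν) • (s⁻¹ • (g - 1)) ^ (a + d) := by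
      rw [← algebraMap_smul K (n * ⟨s, hs⟩ ^ d : ring ν), hn, _root_.smul_pow, smul_smul, smul_smul]
      congr 1
      rw [map_mul, map_pow, map_natCast, show algebraMap (ring ν) K ⟨s, hs⟩ = s from rfl, inv_pow,
        pow_add]
      field_simp
    rw [this]
    exact S.smul_mem (pow_mem hg _) _

/-- The difference vanishes when i > a, so no negative power of s remains. -/
theorem pow_mul_inv_pow_mul_fwdDiff_mem_ring {s : K} (hs : s ∈ ring ν) (hs0 : s ≠ 0) (a i : ℕ) :
    s ^ a * (s ^ i)⁻¹ * ((fwdDiff 1)^[i] (fun n : ℤ => n ^ a) 0 : ℤ) ∈ ring ν := by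
  rcases lt_or_ge a i with hai | hai
  · rw [fwdDiff_iter_pow_eq_zero_of_lt hai]
    simp [zero_mem]
  · rw [← pow_sub₀ _ hs0 hai]
    exact mul_mem (pow_mem hs _) (intCast_mem _ _)

end Integrality

/-! ### Scaled dual bases and reduction of `Hstar`. -/

section Duality

variable {K : Type*} [Field K] {p : ℕ} [CharP K p]
  {ν : AddValuation K (WithTop ℤ)}

variable (p) in
/-- The monomials `(π^{i₁} (ξ₁ - μ ξ₂ - α ξ₃)) ^ a (π^{i₂} (ξ₂ - β ξ₃)) ^ b (π^{i₃} ξ₃) ^ c`. -/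
def scaledMonomial (π : K) (i₁ i₂ i₃ : ℕ) (μ α β : K) (a b c : ℕ) : GrpDual K p :=
  (π ^ i₁ • (xi K p 0 - μ • xi K p 1 - α • xi K p 2)) ^ a *
    (π ^ i₂ • (xi K p 1 - β • xi K p 2)) ^ b * (π ^ i₃ • xi K p 2) ^ c

theorem scaledMonomial_eq_smul (π : K) (i₁ i₂ i₃ : ℕ) (μ α β : K) (a b c : ℕ) :
    scaledMonomial p π i₁ i₂ i₃ μ α β a b c =
      ((π ^ i₁) ^ a * (π ^ i₂) ^ b * (π ^ i₃) ^ c) • dualMonomial p μ α β a b c := by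
  simp only [scaledMonomial, dualMonomial, smul_pow, smul_mul_smul_comm]

theorem scaledMonomial_mem_Hstar (π : K) (i₁ i₂ i₃ : ℕ) (μ α β : K) (a b c : ℕ) :
    scaledMonomial p π i₁ i₂ i₃ μ α β a b c ∈ Hstar ν p π i₁ i₂ i₃ μ α β :=
  pow_mul_pow_mul_pow_mem_adjoin _ _ _ a b c

variable [Fact p.Prime]

variable (p) in
/-- The element of the group ring dual to `scaledMonomial p π i₁ i₂ i₃ μ α β a b c`. -/
def scaledElement (π : K) (i₁ i₂ i₃ : ℕ) (μ α β : K) (a b c : ℕ) : GrpRing K p :=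
  ((π ^ i₁) ^ a * (π ^ i₂) ^ b * (π ^ i₃) ^ c)⁻¹ • dualElement p μ α β a b c

theorem eq_sum_scaledMonomial_smul_scaledElement {π : K} (hπ : π ≠ 0) (i₁ i₂ i₃ : ℕ) (μ α β : K)
    (x : GrpRing K p) : x = ∑ q : Fin p × Fin p × Fin p,
      scaledMonomial p π i₁ i₂ i₃ μ α β q.1 q.2.1 q.2.2 x •
        scaledElement p π i₁ i₂ i₃ μ α β q.1 q.2.1 q.2.2 := by
  conv_lhs => rw [eq_sum_dualMonomial_smul_dualElement μ α β x]
  refine Finset.sum_congr rfl fun q _ => ?_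
  rw [scaledMonomial_eq_smul, scaledElement, smul_smul, WithConv.ofConv_smul,
    LinearMap.smul_apply, smul_eq_mul]
  congr 1
  field_simp

theorem scaledMonomial_apply_scaledElement {π : K} (hπ : π ≠ 0) (i₁ i₂ i₃ : ℕ) (μ α β : K)
    {a b c : ℕ} (ha : a < p) (hb : b < p) (hc : c < p) (a' b' c' : ℕ) :
    scaledMonomial p π i₁ i₂ i₃ μ α β a b c (scaledElement p π i₁ i₂ i₃ μ α β a' b' c') =
      if a' = a ∧ b' = b ∧ c' = c then 1 else 0 := by
  rw [scaledMonomial_eq_smul, scaledElement, WithConv.ofConv_smul, LinearMap.smul_apply, map_smul,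
    dualMonomial_apply_dualElement μ α β ha hb hc]
  split_ifs with h
  · obtain ⟨rfl, rfl, rfl⟩ := h
    simp only [smul_eq_mul, mul_one]
    rw [mul_inv_cancel₀]
    simp [hπ]
  · simp

theorem scaledElement_mem_E {π : K} (hπ : ν π = 1) (i₁ i₂ i₃ : ℕ) (μ α β : K) (a b c : ℕ) :
    scaledElement p π i₁ i₂ i₃ μ α β a b c ∈ E ν p π i₁ i₂ i₃ μ α β := by
  have hR (i : ℕ) := pow_mem (mem_ring_of_valuation_eq_one hπ) i
  have h0 (i : ℕ) := pow_ne_zero i (ne_zero_of_valuation_eq_one hπ)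
  rw [scaledElement, dualElement, mul_inv, mul_inv, ← smul_mul_smul_comm, ← smul_mul_smul_comm]
  refine mul_mem (S := Subalgebra (ring ν) (GrpRing K p)) (mul_mem ?_ ?_) ?_
  · exact smul_newtonSeries_lcoeff_mem (E ν p π i₁ i₂ i₃ μ α β) (hR i₁) (h0 i₁)
      (Algebra.subset_adjoin (Or.inl rfl)) a
  · exact smul_newtonSeries_lcoeff_mem (E ν p π i₁ i₂ i₃ μ α β) (hR i₂) (h0 i₂)
      (Algebra.subset_adjoin (Or.inr (Or.inl rfl))) b
  · exact smul_newtonSeries_lcoeff_mem (E ν p π i₁ i₂ i₃ μ α β) (hR i₃) (h0 i₃)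
      (Algebra.subset_adjoin (Or.inr (Or.inr rfl))) c

/-- Products of the generators of `E` are tested with arbitrary exponents, so no reduction of p-th
powers in `E` is needed. -/
theorem scaledMonomial_apply_mem_ring {π : K} (hπ : ν π = 1) (i₁ i₂ i₃ : ℕ) (μ α β : K)
    {a b c : ℕ} (ha : a < p) (hb : b < p) {x : GrpRing K p}
    (hx : x ∈ E ν p π i₁ i₂ i₃ μ α β) :
    scaledMonomial p π i₁ i₂ i₃ μ α β a b c x ∈ ring ν := by
  have hR (i : ℕ) := pow_mem (mem_ring_of_valuation_eq_one hπ) i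
  have h0 (i : ℕ) := pow_ne_zero i (ne_zero_of_valuation_eq_one hπ)
  rw [E, ← Subalgebra.mem_toSubmodule, Algebra.adjoin_eq_span] at hx
  induction hx using Submodule.span_induction with
  | mem x hx =>
    obtain ⟨i, j, k, rfl⟩ := closure_triple_subset hx
    have h := dualMonomial_apply_sub_one_pow (c := c) μ α β ha hb i j k
    rw [twistThree, twistTwo] at h
    rw [scaledMonomial_eq_smul, WithConv.ofConv_smul, LinearMap.smul_apply, smul_pow, smul_pow,
      smul_pow, smul_mul_smul_comm, smul_mul_smul_comm, map_smul, h]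
    have := mul_mem (mul_mem
      (pow_mul_inv_pow_mul_fwdDiff_mem_ring (hR i₁) (h0 i₁) a i)
      (pow_mul_inv_pow_mul_fwdDiff_mem_ring (hR i₂) (h0 i₂) b j))
      (pow_mul_inv_pow_mul_fwdDiff_mem_ring (hR i₃) (h0 i₃) c k)
    convert this using 1
    simp only [smul_eq_mul, inv_pow]
    ring
  | zero => rw [map_zero]; exact zero_mem _
  | add x y _ _ hx hy => rw [map_add]; exact add_mem hx hy
  | smul r x _ hx =>
    rw [← algebraMap_smul K r, map_smul]
    exact mul_mem r.2 hx

/-- On group elements, the functional `ξ_i` takes values in the prime field. -/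
theorem xi_apply_of_pow (i : Fin 3) (g : Grp p) :
    xi K p i (MonoidAlgebra.of K (Grp p) g) ^ p = xi K p i (MonoidAlgebra.of K (Grp p) g) := by
  rw [xi_apply_of, ← map_pow, ZMod.pow_card]

/-- Since ξᵢ^p = ξᵢ, Frobenius gives (ξ₁ - μξ₂ - αξ₃)^p = (ξ₁ - μξ₂ - αξ₃) - ℘(μ)(ξ₂ - βξ₃) - (℘(α)
+ ℘(μ)β)ξ₃, and (ξ₂ - βξ₃)^p = (ξ₂ - βξ₃) - ℘(β)ξ₃. After scaling by powers of π, the three bounds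
say exactly that the mixed coefficients are integral. -/
theorem Hstar_le_of_scaledMonomial_mem {π : K} (hπ : ν π = 1) {i₁ i₂ i₃ : ℕ} {μ α β : K}
    (hμ : (((i₂ : ℤ) - p * i₁ : ℤ) : WithTop ℤ) ≤ ν (wp p μ))
    (hα : (((i₃ : ℤ) - p * i₁ : ℤ) : WithTop ℤ) ≤ ν (wp p α + wp p μ * β))
    (hβ : (((i₃ : ℤ) - p * i₂ : ℤ) : WithTop ℤ) ≤ ν (wp p β))
    {M : Submodule (ring ν) (GrpDual K p)}
    (hM : ∀ a < p, ∀ b < p, ∀ c < p, scaledMonomial p π i₁ i₂ i₃ μ α β a b c ∈ M) :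
    Subalgebra.toSubmodule (Hstar ν p π i₁ i₂ i₃ μ α β) ≤ M := by
  have hp := (Fact.out : p.Prime)
  have h0 := ne_zero_of_valuation_eq_one hπ
  have hR (i : ℕ) : π ^ (i * (p - 1)) ∈ ring ν := pow_mem (mem_ring_of_valuation_eq_one hπ) _
  have hpow (i : ℕ) : (π ^ i) ^ p = π ^ (i * (p - 1)) * π ^ i := by
    rw [← pow_mul, ← pow_add, ← Nat.mul_add_one, Nat.sub_add_cancel hp.one_le]
  have hμR := pow_mul_div_pow_mem_ring (i := p * i₁) (j := i₂) hπ (by exact_mod_cast hμ)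
  have hαR := pow_mul_div_pow_mem_ring (i := p * i₁) (j := i₃) hπ (by exact_mod_cast hα)
  have hβR := pow_mul_div_pow_mem_ring (i := p * i₂) (j := i₃) hπ (by exact_mod_cast hβ)
  have hpow' (i : ℕ) : π ^ (p * i) = π ^ (i * (p - 1)) * π ^ i := by
    rw [← hpow, ← pow_mul, mul_comm]
  refine adjoin_triple_le_span hp.two_le hM
    ⟨⟨_, hR i₁⟩, -⟨_, hμR⟩, -⟨_, hαR⟩, dual_ext_of fun g => ?_⟩
    ⟨0, ⟨_, hR i₂⟩, -⟨_, hβR⟩, dual_ext_of fun g => ?_⟩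
    ⟨0, 0, ⟨_, hR i₃⟩, dual_ext_of fun g => ?_⟩
  all_goals
    have hx := xi_apply_of_pow (K := K) 0 g
    have hy := xi_apply_of_pow (K := K) 1 g
    have hz := xi_apply_of_pow (K := K) 2 g
    rw [conv_pow_apply_of]
    simp only [WithConv.ofConv_sub, WithConv.ofConv_add, WithConv.ofConv_smul,
      LinearMap.sub_apply, LinearMap.add_apply, LinearMap.smul_apply, Subring.smul_def, smul_eq_mul,
      zero_smul, Subring.coe_neg, WithConv.ofConv_zero, LinearMap.zero_apply]
    generalize xi K p 0 (MonoidAlgebra.of K (Grp p) g) = x at *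
    generalize xi K p 1 (MonoidAlgebra.of K (Grp p) g) = y at *
    generalize xi K p 2 (MonoidAlgebra.of K (Grp p) g) = z at *
    simp only [mul_pow, hpow, sub_pow_char, hx, hy, hz, wp, hpow']
    field_simp
    ring

end Duality

end

end CpCube

/-! ### The duality theorem. -/

theorem mainTheorem3 {K : Type*} [Field K] (p : ℕ) [Fact p.Prime] [CharP K p]
    (ν : AddValuation K (WithTop ℤ)) (_hcomplete : CpCube.IsCompleteFor ν)
    (π : K) (hπ : ν π = 1) (i₁ i₂ i₃ : ℕ) (μ α β : K)
    (hμ : (((i₂ : ℤ) - p * i₁ : ℤ) : WithTop ℤ) ≤ ν (CpCube.wp p μ))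
    (hα : (((i₃ : ℤ) - p * i₁ : ℤ) : WithTop ℤ) ≤ ν (CpCube.wp p α + CpCube.wp p μ * β))
    (hβ : (((i₃ : ℤ) - p * i₂ : ℤ) : WithTop ℤ) ≤ ν (CpCube.wp p β))
    (hμ' : (((i₃ : ℤ) - i₁ : ℤ) : WithTop ℤ) ≤ ν μ) (hi : i₃ ≤ i₂) :
    CpCube.linearDual ν p (Subalgebra.toSubmodule (CpCube.Hstar ν p π i₁ i₂ i₃ μ α β)) =
        Subalgebra.toSubmodule (CpCube.E ν p π i₁ i₂ i₃ μ α β) ∧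
      ∀ φ : CpCube.Hstar ν p π i₁ i₂ i₃ μ α β →ₗ[CpCube.ring ν] CpCube.ring ν,
        ∃! x : CpCube.E ν p π i₁ i₂ i₃ μ α β,
          ∀ f : CpCube.Hstar ν p π i₁ i₂ i₃ μ α β,
            (φ f : K) = (f : CpCube.GrpDual K p) (x : CpCube.GrpRing K p) := by
  have h0 := CpCube.ne_zero_of_valuation_eq_one hπ
  have hP := CpCube.scaledMonomial_mem_Hstar (p := p) (ν := ν) π i₁ i₂ i₃ μ α β
  have hD := CpCube.scaledElement_mem_E (p := p) hπ i₁ i₂ i₃ μ α β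
  have hsum := CpCube.eq_sum_scaledMonomial_smul_scaledElement (p := p) h0 i₁ i₂ i₃ μ α β
  refine ⟨le_antisymm (fun x hx => ?_) (fun x hx f hf => ?_), fun φ => ?_⟩
  · rw [hsum x]
    refine sum_mem fun q _ => ?_
    exact Submodule.smul_mem _ (⟨_, hx _ (hP q.1 q.2.1 q.2.2)⟩ : CpCube.ring ν) (hD _ _ _)
  -- Integrality at x is an R-linear condition on f, so it suffices to check it on scaled monomials
  -- with exponents below p.
  · let M : Submodule (CpCube.ring ν) (CpCube.GrpDual K p) :=
      { carrier := {f | f x ∈ CpCube.ring ν}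
        add_mem' := fun ha hb => (CpCube.ring ν).add_mem ha hb
        zero_mem' := zero_mem (CpCube.ring ν)
        smul_mem' := fun c f hf => mul_mem c.2 hf }
    exact CpCube.Hstar_le_of_scaledMonomial_mem (M := M) hπ hμ hα hβ
      (fun a ha b hb c _ => CpCube.scaledMonomial_apply_mem_ring hπ i₁ i₂ i₃ μ α β ha hb hx) hf
  -- The dual basis forces this x: its coordinates are the values of φ on the scaled monomials.
  · let x : CpCube.GrpRing K p := ∑ q : Fin p × Fin p × Fin p,
      (φ ⟨_, hP q.1 q.2.1 q.2.2⟩ : K) •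
        CpCube.scaledElement p π i₁ i₂ i₃ μ α β q.1 q.2.1 q.2.2
    have hx : x ∈ CpCube.E ν p π i₁ i₂ i₃ μ α β := sum_mem fun q _ =>
      Subalgebra.smul_mem _ (hD _ _ _) (φ ⟨_, hP q.1 q.2.1 q.2.2⟩)
    refine ⟨⟨x, hx⟩, fun f => ?_, fun y hy => Subtype.ext ?_⟩
    -- φ is defined only on `Hstar`, so the submodule on which φ agrees with evaluation at x carries
    -- the membership proof.
    · let M : Submodule (CpCube.ring ν) (CpCube.GrpDual K p) :=
        { carrier := {f | ∃ hf : f ∈ CpCube.Hstar ν p π i₁ i₂ i₃ μ α β, (φ ⟨f, hf⟩ : K) = f x}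
          add_mem' := by
            rintro f g ⟨hf, hfx⟩ ⟨hg, hgx⟩
            refine ⟨add_mem hf hg, ?_⟩
            have := congrArg Subtype.val (map_add φ ⟨f, hf⟩ ⟨g, hg⟩)
            exact this.trans (congrArg₂ (· + ·) hfx hgx)
          zero_mem' := ⟨zero_mem _, congrArg Subtype.val (map_zero φ)⟩
          smul_mem' := by
            rintro r f ⟨hf, hfx⟩
            refine ⟨Subalgebra.smul_mem _ hf r, ?_⟩
            have := congrArg Subtype.val (map_smul φ r ⟨f, hf⟩)
            exact this.trans (congrArg ((r : K) * ·) hfx) }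
      refine (CpCube.Hstar_le_of_scaledMonomial_mem (M := M) hπ hμ hα hβ
        (fun a ha b hb c hc => ⟨hP a b c, ?_⟩) f.2).2
      rw [map_sum, Finset.sum_eq_single (⟨a, ha⟩, ⟨b, hb⟩, ⟨c, hc⟩)]
      · rw [map_smul, CpCube.scaledMonomial_apply_scaledElement h0 i₁ i₂ i₃ μ α β ha hb hc]
        simp
      · intro q _ hq
        rw [map_smul, CpCube.scaledMonomial_apply_scaledElement h0 i₁ i₂ i₃ μ α β ha hb hc,
          if_neg fun h => hq (Prod.ext (Fin.ext h.1) (Prod.ext (Fin.ext h.2.1) (Fin.ext h.2.2))),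
          smul_zero]
      · simp
    · rw [hsum y]
      exact Finset.sum_congr rfl fun q _ => by rw [← hy ⟨_, hP q.1 q.2.1 q.2.2⟩]
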